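/- **Theorem 4.5.** Let $\mathbb X,\mathbb Y$ be real or complex Hilbert spaces, $\Omega\subseteq\mathbb X$ open, and let $F:\Omega\to\mathbb Y$ be analytic such that $F'(x)$ has closed image for every $x\in\Omega$. Let $J:\mathbb X\to\mathbb R\cup\{+\infty\}$ be proper and convex, and lower semicontinuous on $\Omega$ (a functional given only on $\Omega$ is extended by $+\infty$). Let $x_*\in\Omega$, $R>0$, and $$c:=\|F(x_*)\|,\qquad \beta:=\|F'(x_*)^{\dagger}\|,\qquad \kappa:=\beta\|F'(x_*)\|,\qquad \delta:=\sup\{t\in[0,R): B(x_*,t)\subset\Omega\},$$ where $A^\dagger$ is the Moore–Penrose inverse of $A$ and $B(x_*,t)$ is the open ball. Suppose that $F'(x_*)$ is injective, that $-F'(x_*)^*F(x_*)\in\partial J(x_*)$ (subdifferential with respect to $\operatorname{Re}\langle\cdot,\cdot\rangle$), and that $$\gamma:=\sup_{n>1}\left(\beta\left\|\frac{F^{(n)}(x_*)}{n!}\right\|\right)^{1/(n-1)}<+\infty,\qquad h:=2c\gamma\beta\,[(1+\sqrt2)\kappa+1]<1 .$$ Let $a=\gamma c\beta$, $b=(1+\sqrt2)\gamma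 c\beta$, $$p(s):=-4s^4+(1-\kappa+a+b(\kappa-1))s^3+(3+\kappa+a+b(\kappa-1))s^2+(b-1)s+b,$$ $$\bar\rho:=\inf\{s\in(\sqrt2/2,1): p(s)<0\},\qquad r:=\min\{(1-\bar\rho)/\gamma,\ \delta\}\quad(\text{with } r:=\delta \text{ if } \gamma=0).$$ For $H(x):=F'(x)^*F'(x)$ let $\operatorname{prox}_J^{H(x)}(z)$ be the unique minimizer over $y\in\mathbb X$ of $J(y)+\frac12\langle y-z,H(x)(y-z)\rangle$. Then for every starting point $x_0\in B(x_*,r)\setminus\{x_*\}$ the proximal Gauss–Newton method $$x_{k+1}=\operatorname{prox}_J^{H(x_k)}\bigl(x_k-F'(x_k)^{\dagger}F(x_k)\bigr),\qquad k=0,1,\dots,$$ is well defined (at each step $x_k\in\Omega$, $F'(x_k)^\dagger$ exists, $H(x_k)$ is invertible, and the minimizer exists and is unique), the sequence $\{x_k\}$ is contained in $B(x_*,r)$ and converges to $x_*$, and, with $\sigma_0:=\|x_0-x_*\|$, for all $k=0,1,\dots$, $$\|x_{k+1}-x_*\|\le \frac{\gamma\,[1+(\kappa-1)(1-\gamma\sigma_0)^2]}{[1-2(1-\gamma\sigma_0)^2]^2}\|x_k-x_*\|^2+\frac{(1+\sqrt2)\beta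 c\gamma^2(2-\gamma\sigma_0)^2}{[1-2(1-\gamma\sigma_0)^2]^2}\|x_k-x_*\|^2+\frac{c\beta\gamma\,[(1+\sqrt2)\kappa+1](2-\gamma\sigma_0)(1-\gamma\sigma_0)^2}{[1-2(1-\gamma\sigma_0)^2]^2}\|x_k-x_*\| .$$ -/

import Mathlib

open Filter Topology
open scoped Nat

noncomputable section

namespace ProxGN

variable {𝕜 X Y : Type*} [RCLike 𝕜]
  [NormedAddCommGroup X] [InnerProductSpace 𝕜 X]
  [NormedAddCommGroup Y] [InnerProductSpace 𝕜 Y]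

/-- `B` is a Moore-Penrose inverse of `A`: the four Penrose equations. -/
structure IsMoorePenrose [CompleteSpace X] [CompleteSpace Y]
    (A : X →L[𝕜] Y) (B : Y →L[𝕜] X) : Prop where
  aba : A ∘L B ∘L A = A
  bab : B ∘L A ∘L B = B
  ab_adj : ContinuousLinearMap.adjoint (A ∘L B) = A ∘L B
  ba_adj : ContinuousLinearMap.adjoint (B ∘L A) = B ∘L A

/-- A bounded operator has at most one Moore-Penrose inverse. -/
theorem IsMoorePenrose.unique [CompleteSpace X] [CompleteSpace Y]
    {A : X →L[𝕜] Y} {B C : Y →L[𝕜] X}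
    (hB : IsMoorePenrose A B) (hC : IsMoorePenrose A C) : B = C := by
  have h1 : A ∘L B = A ∘L C := by
    have e : (A ∘L C) ∘L (A ∘L B) = A ∘L B := by
      have := congrArg (fun T => T ∘L B) hC.aba
      simpa only [ContinuousLinearMap.comp_assoc] using this
    have e' : (A ∘L B) ∘L (A ∘L C) = A ∘L C := by
      have := congrArg (fun T => T ∘L C) hB.aba
      simpa only [ContinuousLinearMap.comp_assoc] using this
    have := congrArg ContinuousLinearMap.adjoint e
    rw [ContinuousLinearMap.adjoint_comp, hB.ab_adj, hC.ab_adj, e'] at this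
    exact this.symm
  have h2 : B ∘L A = C ∘L A := by
    have e : (B ∘L A) ∘L (C ∘L A) = B ∘L A := by
      have := congrArg (fun T => B ∘L T) hC.aba
      simpa only [ContinuousLinearMap.comp_assoc] using this
    have e' : (C ∘L A) ∘L (B ∘L A) = C ∘L A := by
      have := congrArg (fun T => C ∘L T) hB.aba
      simpa only [ContinuousLinearMap.comp_assoc] using this
    have := congrArg ContinuousLinearMap.adjoint e
    rw [ContinuousLinearMap.adjoint_comp, hB.ba_adj, hC.ba_adj, e'] at this
    exact this.symm
  calc B = B ∘L A ∘L B := hB.bab.symm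
    _ = B ∘L A ∘L C := by rw [h1]
    _ = (B ∘L A) ∘L C := rfl
    _ = (C ∘L A) ∘L C := by rw [h2]
    _ = C := hC.bab

open Classical in
/-- The Moore-Penrose inverse `A†` (with the value `0` when there is none). -/
def pinv [CompleteSpace X] [CompleteSpace Y] (A : X →L[𝕜] Y) : Y →L[𝕜] X :=
  if h : ∃ B, IsMoorePenrose A B then h.choose else 0

/-- An injective bounded operator with closed range has a Moore-Penrose inverse. -/
theorem isMoorePenrose_pinv [CompleteSpace X] [CompleteSpace Y] (A : X →L[𝕜] Y)
    (hinj : Function.Injective A) (hcl : IsClosed (Set.range A)) :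
    IsMoorePenrose A (pinv A) := by
  have hex : ∃ B, IsMoorePenrose A B := by
    let e : X ≃L[𝕜] A.range := A.equivRange hinj hcl
    have : CompleteSpace A.range := hcl.completeSpace_coe
    have hA : ∀ x, A x = (e x : Y) := fun x => rfl
    let B : Y →L[𝕜] X :=
      (e.symm : A.range →L[𝕜] X) ∘L A.range.orthogonalProjectionOnto
    have hBA : B ∘L A = ContinuousLinearMap.id 𝕜 X := by
      ext x
      simp [B, hA]
    have hAB : A ∘L B = A.range.starProjection := by
      ext y
      simp [B, hA]
    refine ⟨B, ?_, ?_, ?_, ?_⟩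
    · rw [hBA]; rfl
    · rw [← ContinuousLinearMap.comp_assoc, hBA]; rfl
    · rw [hAB]
      exact (isSelfAdjoint_starProjection A.range).adjoint_eq
    · rw [hBA]
      exact (IsSelfAdjoint.one (X →L[𝕜] X)).adjoint_eq
  unfold pinv
  rw [dif_pos hex]
  exact hex.choose_spec

variable (𝕜) in
/-- A proper convex functional `J : X → ℝ ∪ {+∞}`; convexity is convexity of the epigraph,
written out (real scalars act through `ℝ ⊆ 𝕜`). A functional given only on a subset of `X`
is extended by `+∞`. -/
structure IsProperConvex (J : X → EReal) : Prop where
  ne_bot : ∀ x, J x ≠ ⊥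
  exists_ne_top : ∃ x, J x ≠ ⊤
  convex : ∀ (x y : X) (s t a b : ℝ), J x ≤ (s : EReal) → J y ≤ (t : EReal) →
    0 ≤ a → 0 ≤ b → a + b = 1 →
      J ((a : 𝕜) • x + (b : 𝕜) • y) ≤ ((a * s + b * t : ℝ) : EReal)

variable (𝕜) in
/-- The subdifferential `∂J(p)`, with respect to the real inner product `Re ⟪·, ·⟫`. -/
def subdifferential (J : X → EReal) (p : X) : Set X :=
  {v | J p ≠ ⊤ ∧ ∀ y, J p + ((RCLike.re (inner 𝕜 v (y - p)) : ℝ) : EReal) ≤ J y}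

/-- The objective `y ↦ J(y) + ½ ‖y - z‖_H²`, where `‖u‖_H² = ⟨u, H u⟩`. -/
def proxObjective (J : X → EReal) (H : X →L[𝕜] X) (z y : X) : EReal :=
  J y + ((1 / 2 * RCLike.re (inner 𝕜 (y - z) (H (y - z))) : ℝ) : EReal)

/-- `p = prox_J^H(z)`: the point `p` is a minimizer over `X` of `J(y) + ½ ‖y - z‖_H²`, and it is
the only one. -/
def IsProx (J : X → EReal) (H : X →L[𝕜] X) (z p : X) : Prop :=
  (∀ y, proxObjective J H z p ≤ proxObjective J H z y) ∧
  ∀ q, (∀ y, proxObjective J H z q ≤ proxObjective J H z y) → q = p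

variable (𝕜) in
/-- The operator `H(x) = F'(x)^* F'(x)`. -/
def gnH [CompleteSpace X] [CompleteSpace Y] (F : X → Y) (x : X) : X →L[𝕜] X :=
  ContinuousLinearMap.adjoint (fderiv 𝕜 F x) ∘L fderiv 𝕜 F x

variable (𝕜) in
/-- The proximal Gauss-Newton step is defined at `x` and leads to `x'`: the point `x` lies in the
domain `Ω` of `F`, the operator `F'(x)` has a Moore-Penrose inverse, `H(x)` is invertible, and
`x' = prox_J^{H(x)} (x - F'(x)† F(x))`, where the minimizer exists and is unique. -/
structure IsProxGNStep [CompleteSpace X] [CompleteSpace Y]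
    (Ω : Set X) (F : X → Y) (J : X → EReal) (x x' : X) : Prop where
  mem : x ∈ Ω
  moorePenrose : IsMoorePenrose (fderiv 𝕜 F x) (pinv (fderiv 𝕜 F x))
  isUnit : IsUnit (gnH 𝕜 F x)
  isProx : IsProx J (gnH 𝕜 F x) (x - pinv (fderiv 𝕜 F x) (F x)) x'

end ProxGN

end

/-! Write A = F'(x), A₀ = F'(x⋆), f₀ = F(x⋆), σ = ‖x - x⋆‖, w = 1 - γσ, and let e be the error after
one step. Strong convexity of the proximal objective, tested against the subgradient -A₀*f₀ at x⋆,
bounds ‖Ae‖² by inner products. As AA† is the orthogonal projection onto the range of A, the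
pseudoinverse drops out of them. If ‖u‖ ≤ M‖Au‖ for all u, then ‖e‖ ≤ M‖A(x - x⋆) - F(x) + f₀‖ +
M²‖A - A₀‖‖f₀‖ (`norm_le_of_variational_inequality`); no perturbation bound for A† is needed.

The definition of γ dominates the Taylor coefficients at x⋆ by γⁿ⁻¹/β, so geometric series bound
both differences (`analytic_estimates_of_norm_taylorSeries_le`), and perturbing A₀ gives M =
βw²/(2w² - 1). The resulting estimate is at most the stated bound (`le_stepBound`).

That bound is at most θσ, where p(s) < 0 says θ < 1 at w = s. Since p(1) = h - 1 < 0, such s exist,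
and θ decreases in w (`rateNumerator_lt_of_le`), so θ < 1 throughout the ball and the iteration
contracts.

As `J` is lower semicontinuous only on Ω, existence of the proximal point needs care. A minimizing
sequence always converges, and its limit obeys the error estimate even before it is known to be a
minimizer. The estimate places it in Ω, where semicontinuity makes it the minimizer
(`exists_isProx_of_lowerSemicontinuousAt`). -/

noncomputable section

namespace ProxGN

/-! ### Proximal points of strongly convex quadratics -/

section Prox

variable {𝕜 X Y : Type*} [RCLike 𝕜]
  [NormedAddCommGroup X] [InnerProductSpace 𝕜 X]
  [NormedAddCommGroup Y] [InnerProductSpace 𝕜 Y]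

variable (𝕜) in
theorem norm_sq_convex_combination (u v : Y) {a b : ℝ} (hab : a + b = 1) :
    ‖(a : 𝕜) • u + (b : 𝕜) • v‖ ^ 2 = a * ‖u‖ ^ 2 + b * ‖v‖ ^ 2 - a * b * ‖u - v‖ ^ 2 := by
  have hb : b = 1 - a := by linarith
  rw [@norm_add_sq 𝕜, @norm_sub_sq 𝕜, norm_smul, norm_smul, inner_smul_left, inner_smul_right]
  simp only [RCLike.conj_ofReal, RCLike.re_ofReal_mul, RCLike.norm_ofReal, mul_pow, sq_abs]
  subst hb
  ring

/-- The real-valued form of `proxObjective` for `H = A^* A`, meaningful where `J` is finite. -/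
def realObjective (J : X → EReal) (A : X →L[𝕜] Y) (z y : X) : ℝ :=
  (J y).toReal + 1 / 2 * ‖A (y - z)‖ ^ 2

theorem proxObjective_adjoint_comp [CompleteSpace X] [CompleteSpace Y] (J : X → EReal)
    (A : X →L[𝕜] Y) (z y : X) :
    proxObjective J (ContinuousLinearMap.adjoint A ∘L A) z y =
      J y + ((1 / 2 * ‖A (y - z)‖ ^ 2 : ℝ) : EReal) := by
  rw [proxObjective, ContinuousLinearMap.comp_apply, ContinuousLinearMap.adjoint_inner_right,
    inner_self_eq_norm_sq]

theorem proxObjective_eq_realObjective [CompleteSpace X] [CompleteSpace Y] {J : X → EReal}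
    (hJ : IsProperConvex 𝕜 J) (A : X →L[𝕜] Y) (z : X) {y : X} (hy : J y ≠ ⊤) :
    proxObjective J (ContinuousLinearMap.adjoint A ∘L A) z y =
      (realObjective J A z y : EReal) := by
  rw [proxObjective_adjoint_comp, realObjective, EReal.coe_add, EReal.coe_toReal hy (hJ.ne_bot y)]

theorem IsProperConvex.ne_top_combination {J : X → EReal} (hJ : IsProperConvex 𝕜 J) {x y : X}
    (hx : J x ≠ ⊤) (hy : J y ≠ ⊤) {a b : ℝ} (ha : 0 ≤ a) (hb : 0 ≤ b) (hab : a + b = 1) :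
    J ((a : 𝕜) • x + (b : 𝕜) • y) ≠ ⊤ :=
  ne_top_of_le_ne_top (EReal.coe_ne_top _) (hJ.convex x y (J x).toReal (J y).toReal a b
    (EReal.coe_toReal hx (hJ.ne_bot x)).ge (EReal.coe_toReal hy (hJ.ne_bot y)).ge ha hb hab)

theorem IsProperConvex.realObjective_combination_le {J : X → EReal} (hJ : IsProperConvex 𝕜 J)
    (A : X →L[𝕜] Y) (z : X) {x y : X}
    (hx : J x ≠ ⊤) (hy : J y ≠ ⊤) {a b : ℝ} (ha : 0 ≤ a) (hb : 0 ≤ b) (hab : a + b = 1) :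
    realObjective J A z ((a : 𝕜) • x + (b : 𝕜) • y) ≤
      a * realObjective J A z x + b * realObjective J A z y
        - 1 / 2 * (a * b * ‖A (x - y)‖ ^ 2) := by
  have h1 := hJ.convex x y (J x).toReal (J y).toReal a b
    (EReal.coe_toReal hx (hJ.ne_bot x)).ge (EReal.coe_toReal hy (hJ.ne_bot y)).ge ha hb hab
  have h2 := hJ.ne_top_combination hx hy ha hb hab
  rw [← EReal.coe_toReal h2 (hJ.ne_bot _), EReal.coe_le_coe_iff] at h1
  have h3 : A ((a : 𝕜) • x + (b : 𝕜) • y - z) = (a : 𝕜) • A (x - z) + (b : 𝕜) • A (y - z) := by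
    have : (a : 𝕜) • z + (b : 𝕜) • z = z := by
      rw [← add_smul, ← RCLike.ofReal_add, hab, RCLike.ofReal_one, one_smul]
    rw [← map_smul, ← map_smul, ← map_add, smul_sub, smul_sub]
    congr 1
    nth_rewrite 1 [← this]
    abel
  have h4 : A (x - y) = A (x - z) - A (y - z) := by rw [← map_sub]; congr 1; abel
  rw [realObjective, h3, norm_sq_convex_combination 𝕜 _ _ hab, h4]
  unfold realObjective
  linarith

theorem realObjective_ge_of_mem_subdifferential {J : X → EReal} (hJ : IsProperConvex 𝕜 J)
    {v p : X} (hv : v ∈ subdifferential 𝕜 J p) (A : X →L[𝕜] Y) (z : X) {y : X} (hy : J y ≠ ⊤) :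
    (J p).toReal + RCLike.re (inner 𝕜 v (y - p)) + 1 / 2 * ‖A (y - z)‖ ^ 2 ≤
      realObjective J A z y := by
  have h := hv.2 y
  rw [← EReal.coe_toReal hv.1 (hJ.ne_bot p), ← EReal.coe_toReal hy (hJ.ne_bot y),
    ← EReal.coe_add, EReal.coe_le_coe_iff] at h
  unfold realObjective
  linarith

/-- The subgradient supplies an affine minorant of `J`. Since `A` is bounded below, the quadratic
term absorbs its linear decay: t²/2 - ‖v‖Bt ≥ -(‖v‖B)²/2 with t = ‖A(y - z)‖. -/
theorem realObjective_bddBelow {J : X → EReal} (hJ : IsProperConvex 𝕜 J)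
    {v p : X} (hv : v ∈ subdifferential 𝕜 J p) (A : X →L[𝕜] Y) (z : X) {B : ℝ}
    (hB : ∀ x, ‖x‖ ≤ B * ‖A x‖) :
    BddBelow (realObjective J A z '' {y | J y ≠ ⊤}) := by
  refine ⟨(J p).toReal - ‖v‖ * ‖z - p‖ - 1 / 2 * (‖v‖ * B) ^ 2, ?_⟩
  rintro _ ⟨y, hy, rfl⟩
  have h1 := realObjective_ge_of_mem_subdifferential hJ hv A z hy
  have h2 : -(‖v‖ * ‖y - p‖) ≤ RCLike.re (inner 𝕜 v (y - p)) :=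
    (abs_le.1 ((RCLike.abs_re_le_norm _).trans (norm_inner_le_norm v (y - p)))).1
  have h3 : ‖y - p‖ ≤ ‖y - z‖ + ‖z - p‖ := norm_sub_le_norm_sub_add_norm_sub y z p
  have h4 := mul_le_mul_of_nonneg_left (h3.trans (add_le_add_left (hB (y - z)) _)) (norm_nonneg v)
  nlinarith [sq_nonneg (‖v‖ * B - ‖A (y - z)‖)]

/-- A proximal step at `z` for a strongly convex quadratic term: minimizing sequences converge to
a point `p`, which satisfies the variational estimate against a point of the graph of `∂J` and is
the proximal point as soon as `J` is lower semicontinuous there. -/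
theorem exists_isProx_of_lowerSemicontinuousAt [CompleteSpace X] [CompleteSpace Y] {J : X → EReal}
    (hJ : IsProperConvex 𝕜 J) {v q : X} (hv : v ∈ subdifferential 𝕜 J q) (A : X →L[𝕜] Y) (z : X)
    {B : ℝ} (hB : ∀ x, ‖x‖ ≤ B * ‖A x‖) :
    ∃ p, (LowerSemicontinuousAt J p → IsProx J (ContinuousLinearMap.adjoint A ∘L A) z p) ∧
      ‖A (p - q)‖ ^ 2 ≤
        -RCLike.re (inner 𝕜 v (p - q)) - RCLike.re (inner 𝕜 (A (p - q)) (A (q - z))) := by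
  set f := realObjective J A z with hf
  set D : Set X := {y | J y ≠ ⊤} with hD
  have hqD : q ∈ D := hv.1
  have hbdd : BddBelow (f '' D) := realObjective_bddBelow hJ hv A z hB
  set m := sInf (f '' D) with hm
  have hmle : ∀ y ∈ D, m ≤ f y := fun y hy => csInf_le hbdd ⟨y, hy, rfl⟩
  have hex : ∀ n : ℕ, ∃ y ∈ D, f y < m + 1 / ((n : ℝ) + 1) := by
    intro n
    obtain ⟨_, ⟨y, hy, rfl⟩, hlt⟩ := exists_lt_of_csInf_lt (⟨f q, q, hqD, rfl⟩ : (f '' D).Nonempty)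
      (show sInf (f '' D) < m + 1 / ((n : ℝ) + 1) from lt_add_of_pos_right _ (by positivity))
    exact ⟨y, hy, hlt⟩
  choose y hyD hylt using hex
  have hstrong : ∀ s ∈ D, ∀ t ∈ D, ∀ a b : ℝ, 0 ≤ a → 0 ≤ b → a + b = 1 →
      m + 1 / 2 * (a * b * ‖A (s - t)‖ ^ 2) ≤ a * f s + b * f t := by
    intro s hs t ht a b ha hb hab
    have h1 := hJ.realObjective_combination_le A z hs ht ha hb hab
    have h2 := hmle _ (hJ.ne_top_combination hs ht ha hb hab)
    simp only [hf] at *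
    linarith
  have hfy : Tendsto (fun n => f (y n)) atTop (𝓝 m) := by
    refine tendsto_of_tendsto_of_tendsto_of_le_of_le tendsto_const_nhds
      (h := fun n : ℕ => m + 1 / ((n : ℝ) + 1)) ?_ (fun n => hmle _ (hyD n))
      (fun n => (hylt n).le)
    simpa using tendsto_const_nhds.add (tendsto_one_div_add_atTop_nhds_zero_nat (𝕜 := ℝ))
  have hcauchy : CauchySeq y := by
    rw [Metric.cauchySeq_iff']
    intro ε hε
    -- Testing the midpoint of two almost minimizers, with excess below η, gives ‖A(yₙ - y_N)‖² <
    -- 8η. The summand 1 covers `B = 0`.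
    have hη : 0 < ε ^ 2 / (8 * (B ^ 2 + 1)) := by positivity
    obtain ⟨N, hN⟩ := exists_nat_one_div_lt hη
    refine ⟨N, fun n hn => ?_⟩
    rw [dist_eq_norm]
    have h1 := hstrong (y n) (hyD n) (y N) (hyD N) (1 / 2) (1 / 2) (by norm_num) (by norm_num)
      (by norm_num)
    have h2 := (hylt n).trans_le (add_le_add_right (Nat.one_div_le_one_div (α := ℝ) hn) m)
    have h3 := hylt N
    have h4 : ‖A (y n - y N)‖ ^ 2 < 8 * (ε ^ 2 / (8 * (B ^ 2 + 1))) := by linarith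
    have h5 : 8 * (ε ^ 2 / (8 * (B ^ 2 + 1))) = ε ^ 2 / (B ^ 2 + 1) := by field_simp
    rw [h5, lt_div_iff₀ (by positivity)] at h4
    have h6 : ‖y n - y N‖ ^ 2 ≤ (B * ‖A (y n - y N)‖) ^ 2 :=
      pow_le_pow_left₀ (norm_nonneg _) (hB _) 2
    refine lt_of_pow_lt_pow_left₀ 2 hε.le (h6.trans_lt ?_)
    nlinarith [sq_nonneg ‖A (y n - y N)‖]
  obtain ⟨p, hp⟩ := cauchySeq_tendsto_of_complete hcauchy
  have hnp : Tendsto (fun n => 1 / 2 * ‖A (y n - z)‖ ^ 2) atTop (𝓝 (1 / 2 * ‖A (p - z)‖ ^ 2)) := by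
    have : Continuous fun x : X => 1 / 2 * ‖A (x - z)‖ ^ 2 := by fun_prop
    exact (this.tendsto p).comp hp
  refine ⟨p, fun hlsc => ?_, ?_⟩
  · have hJp : J p ≤ ((m - 1 / 2 * ‖A (p - z)‖ ^ 2 : ℝ) : EReal) := by
      refine le_of_forall_lt fun c hc => ?_
      obtain ⟨c', hcc', hc'⟩ := exists_between hc
      refine hcc'.trans_le ?_
      have h1 : ∀ᶠ n in atTop, c' < J (y n) := hp.eventually (hlsc c' hc')
      have h2 : Tendsto (fun n => ((f (y n) - 1 / 2 * ‖A (y n - z)‖ ^ 2 : ℝ) : EReal)) atTop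
          (𝓝 ((m - 1 / 2 * ‖A (p - z)‖ ^ 2 : ℝ) : EReal)) :=
        (continuous_coe_real_ereal.tendsto _).comp (hfy.sub hnp)
      refine ge_of_tendsto h2 (h1.mono fun n hn => hn.le.trans ?_)
      rw [← EReal.coe_toReal (hyD n) (hJ.ne_bot (y n)), EReal.coe_le_coe_iff, hf, realObjective]
      linarith
    have hpD : p ∈ D := ne_top_of_le_ne_top (EReal.coe_ne_top _) hJp
    have hfp : f p ≤ m := by
      rw [← EReal.coe_toReal hpD (hJ.ne_bot p), EReal.coe_le_coe_iff] at hJp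
      rw [hf, realObjective]
      linarith
    refine ⟨fun x => ?_, fun x hx => ?_⟩
    · by_cases hxD : J x = ⊤
      · rw [proxObjective_adjoint_comp _ _ _ x, hxD, EReal.top_add_coe]
        exact le_top
      · rw [proxObjective_eq_realObjective hJ A z hpD, proxObjective_eq_realObjective hJ A z hxD,
          EReal.coe_le_coe_iff]
        exact hfp.trans (hmle x hxD)
    · have h1 := hx p
      have hxD : J x ≠ ⊤ := by
        intro h
        rw [proxObjective_adjoint_comp _ _ _ x, h, EReal.top_add_coe,
          proxObjective_eq_realObjective hJ A z hpD] at h1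
        exact EReal.coe_ne_top _ (top_le_iff.1 h1)
      rw [proxObjective_eq_realObjective hJ A z hpD, proxObjective_eq_realObjective hJ A z hxD,
        EReal.coe_le_coe_iff] at h1
      have h2 := hstrong x hxD p hpD (1 / 2) (1 / 2) (by norm_num) (by norm_num) (by norm_num)
      have h3 : ‖A (x - p)‖ ^ 2 ≤ 0 := by
        simp only [hf] at *
        linarith
      have h4 : ‖A (x - p)‖ = 0 := pow_eq_zero_iff two_ne_zero |>.1 (le_antisymm h3 (sq_nonneg _))
      have h5 := hB (x - p)
      rw [h4, mul_zero] at h5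
      exact sub_eq_zero.1 (norm_le_zero_iff.1 h5)
  · have hcont : Continuous fun x : X => 1 / 2 * ‖A (x - q)‖ ^ 2 := by fun_prop
    have hnq := (hcont.tendsto p).comp hp
    -- Strong convexity is applied between yₙ and `q`; then n → ∞, division by the weight `b` of
    -- `q`, and finally b → 0. Only the infimum `m` enters, never `J p`, so semicontinuity is not
    -- used.
    have h1 : ∀ b ∈ Set.Ioo (0 : ℝ) 1, m + 1 / 2 * ((1 - b) * ‖A (p - q)‖ ^ 2) ≤ f q := by
      intro b hb
      have h2 : m + (1 - b) * b * (1 / 2 * ‖A (p - q)‖ ^ 2) ≤ (1 - b) * m + b * f q := by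
        refine le_of_tendsto_of_tendsto' ((hnq.const_mul ((1 - b) * b)).const_add m)
          ((hfy.const_mul (1 - b)).add_const (b * f q)) fun n => ?_
        have := hstrong (y n) (hyD n) q hqD (1 - b) b (by linarith [hb.2]) hb.1.le (by ring)
        simp only [Function.comp]
        linarith
      have h3 : b * (m + 1 / 2 * ((1 - b) * ‖A (p - q)‖ ^ 2)) ≤ b * f q := by linarith
      exact le_of_mul_le_mul_left h3 hb.1
    have h2 : m + 1 / 2 * ‖A (p - q)‖ ^ 2 ≤ f q := by
      have : Tendsto (fun b : ℝ => m + 1 / 2 * ((1 - b) * ‖A (p - q)‖ ^ 2)) (𝓝[>] 0)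
          (𝓝 (m + 1 / 2 * ((1 - 0) * ‖A (p - q)‖ ^ 2))) := by
        have hc : Continuous fun b : ℝ => m + 1 / 2 * ((1 - b) * ‖A (p - q)‖ ^ 2) := by fun_prop
        exact (hc.tendsto 0).mono_left nhdsWithin_le_nhds
      rw [sub_zero, one_mul] at this
      refine le_of_tendsto this ?_
      filter_upwards [Ioo_mem_nhdsGT (zero_lt_one (α := ℝ))] with b hb using h1 b hb
    have h3 : (J q).toReal + RCLike.re (inner 𝕜 v (p - q)) + 1 / 2 * ‖A (p - z)‖ ^ 2 ≤ m := by
      have hc : Continuous fun x : X => (J q).toReal + RCLike.re (inner 𝕜 v (x - q)) := by fun_prop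
      exact le_of_tendsto_of_tendsto' (((hc.tendsto p).comp hp).add hnp) hfy fun n =>
        realObjective_ge_of_mem_subdifferential hJ hv A z (hyD n)
    have h4 : A (p - z) = A (p - q) + A (q - z) := by rw [← map_add]; congr 1; abel
    rw [h4, @norm_add_sq 𝕜] at h3
    rw [hf, realObjective] at h2
    linarith

end Prox

/-! ### Moore–Penrose inverses of injective operators -/

section MoorePenrose

variable {𝕜 X Y : Type*} [RCLike 𝕜]
  [NormedAddCommGroup X] [InnerProductSpace 𝕜 X] [CompleteSpace X]
  [NormedAddCommGroup Y] [InnerProductSpace 𝕜 Y] [CompleteSpace Y]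
  {A : X →L[𝕜] Y} {B : Y →L[𝕜] X}

theorem IsMoorePenrose.comp_eq_id (h : IsMoorePenrose A B) (hinj : Function.Injective A) :
    B ∘L A = ContinuousLinearMap.id 𝕜 X := by
  ext x
  exact hinj (congrArg (fun T : X →L[𝕜] Y => T x) h.aba)

/-- The inverse of A*A is BB*: use B*A* = AB, A*AB = A* and BA = 1. -/
theorem IsMoorePenrose.isUnit_adjoint_comp (h : IsMoorePenrose A B)
    (hinj : Function.Injective A) : IsUnit (ContinuousLinearMap.adjoint A ∘L A) := by
  have hBA := h.comp_eq_id hinj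
  have hAB : ContinuousLinearMap.adjoint B ∘L ContinuousLinearMap.adjoint A = A ∘L B := by
    rw [← ContinuousLinearMap.adjoint_comp, h.ab_adj]
  have hadj : ContinuousLinearMap.adjoint A ∘L ContinuousLinearMap.adjoint B =
      ContinuousLinearMap.id 𝕜 X := by
    rw [← ContinuousLinearMap.adjoint_comp, h.ba_adj, hBA]
  have hABA : ContinuousLinearMap.adjoint A ∘L (A ∘L B) = ContinuousLinearMap.adjoint A := by
    rw [← h.ab_adj, ← ContinuousLinearMap.adjoint_comp, ContinuousLinearMap.comp_assoc, h.aba]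
  refine ⟨⟨_, B ∘L ContinuousLinearMap.adjoint B, ?_, ?_⟩, rfl⟩
  · calc (ContinuousLinearMap.adjoint A ∘L A) ∘L (B ∘L ContinuousLinearMap.adjoint B)
        = (ContinuousLinearMap.adjoint A ∘L (A ∘L B)) ∘L ContinuousLinearMap.adjoint B := rfl
      _ = 1 := by rw [hABA, hadj]; rfl
  · calc (B ∘L ContinuousLinearMap.adjoint B) ∘L (ContinuousLinearMap.adjoint A ∘L A)
        = B ∘L (ContinuousLinearMap.adjoint B ∘L ContinuousLinearMap.adjoint A) ∘L A := rfl
      _ = (B ∘L A) ∘L (B ∘L A) := by rw [hAB]; rfl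
      _ = 1 := by rw [hBA]; rfl

theorem IsMoorePenrose.norm_le (h : IsMoorePenrose A B) (hinj : Function.Injective A) (x : X) :
    ‖x‖ ≤ ‖B‖ * ‖A x‖ := by
  have : B (A x) = x := congrArg (fun T : X →L[𝕜] X => T x) (h.comp_eq_id hinj)
  calc ‖x‖ = ‖B (A x)‖ := by rw [this]
    _ ≤ ‖B‖ * ‖A x‖ := B.le_opNorm _

/-- AB is self-adjoint and fixes the range of A. This removes the pseudoinverse from the variational
inequality. -/
theorem IsMoorePenrose.inner_apply_comp (h : IsMoorePenrose A B) (x : X) (y : Y) :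
    inner 𝕜 (A x) (A (B y)) = inner 𝕜 (A x) y := by
  have h1 : A (B (A x)) = A x := congrArg (fun T : X →L[𝕜] Y => T x) h.aba
  have h2 := ContinuousLinearMap.adjoint_inner_left (A ∘L B) y (A x)
  rw [h.ab_adj] at h2
  simp only [ContinuousLinearMap.comp_apply] at h2
  rw [← h2, h1]

end MoorePenrose

/-! ### Geometric majorants for power series -/

section Series

variable {𝕜 E F : Type*} [NontriviallyNormedField 𝕜]
  [NormedAddCommGroup E] [NormedSpace 𝕜 E] [NormedAddCommGroup F] [NormedSpace 𝕜 F]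

/-- The coefficient is a sum over the n-element subsets of n + 1 slots, and each summand has norm at
most ‖p (n + 1)‖. -/
theorem norm_derivSeries_le (p : FormalMultilinearSeries 𝕜 E F) (n : ℕ) :
    ‖p.derivSeries n‖ ≤ (n + 1) * ‖p (n + 1)‖ := by
  have h1 : ‖p.derivSeries n‖ ≤ ‖p.changeOriginSeries 1 n‖ := by
    refine (ContinuousLinearMap.norm_compContinuousMultilinearMap_le _ _).trans ?_
    exact mul_le_of_le_one_left (norm_nonneg _)
      (ContinuousLinearMap.opNorm_le_bound _ zero_le_one (by simp))
  have h2 : ‖p.changeOriginSeries 1 n‖ ≤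
      ∑ _s : { s : Finset (Fin (1 + n)) // s.card = n }, ‖p (1 + n)‖ := by
    have := p.nnnorm_changeOriginSeries_le_tsum 1 n
    rw [tsum_fintype, ← NNReal.coe_le_coe, NNReal.coe_sum] at this
    exact this
  refine h1.trans (h2.trans_eq ?_)
  rw [Finset.sum_const, Finset.card_univ, nsmul_eq_mul, Fintype.card_finset_len, Fintype.card_fin,
    add_comm 1 n, Nat.choose_succ_self_right, Nat.cast_succ]

theorem hasSum_succ_mul_geometric {u : ℝ} (h0 : 0 ≤ u) (h1 : u < 1) :
    HasSum (fun n : ℕ => ((n : ℝ) + 1) * u ^ n) (1 / (1 - u) ^ 2) := by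
  have hu : ‖u‖ < 1 := by rwa [Real.norm_of_nonneg h0]
  have h := (hasSum_coe_mul_geometric_of_norm_lt_one hu).add (hasSum_geometric_of_norm_lt_one hu)
  have h2 : 1 - u ≠ 0 := by linarith
  convert! h using 1
  · ext n; ring
  · field_simp; ring

variable [CompleteSpace F] {p : FormalMultilinearSeries 𝕜 E F} {f : E → F} {x : E} {s : ENNReal}
  {C γ : ℝ}

/-- Majorization of `f'(x + y) - f'(x)` by a geometric series bounding the coefficients. -/
theorem norm_fderiv_sub_le_of_hasFPowerSeriesOnBall (hf : HasFPowerSeriesOnBall f p x s)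
    (hγ : 0 ≤ γ) (hp : ∀ n, ‖p (n + 2)‖ ≤ C * γ ^ (n + 1)) {y : E}
    (hy : y ∈ Metric.eball (0 : E) s) (hy1 : γ * ‖y‖ < 1) :
    ‖fderiv 𝕜 f (x + y) - fderiv 𝕜 f x‖ ≤ C * (1 / (1 - γ * ‖y‖) ^ 2 - 1) := by
  have h0 : fderiv 𝕜 f x = p.derivSeries 0 fun _ => y := (hf.fderiv.coeff_zero _).symm
  have h1 := (hasSum_nat_add_iff' 1).2 (hf.fderiv.hasSum hy)
  have h2 := ((hasSum_nat_add_iff' 1).2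
    (hasSum_succ_mul_geometric (mul_nonneg hγ (norm_nonneg y)) hy1)).mul_left C
  simp only [Finset.sum_range_one, Nat.cast_zero, zero_add, pow_zero, mul_one] at h1 h2
  rw [h0]
  refine h1.norm_le_of_bounded h2 fun n => ?_
  refine ((p.derivSeries (n + 1)).le_opNorm _).trans ?_
  simp only [Finset.prod_const, Finset.card_univ, Fintype.card_fin]
  calc ‖p.derivSeries (n + 1)‖ * ‖y‖ ^ (n + 1)
      ≤ (((n + 1 : ℕ) : ℝ) + 1) * (C * γ ^ (n + 1)) * ‖y‖ ^ (n + 1) := by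
        gcongr
        exact (norm_derivSeries_le p (n + 1)).trans
          (mul_le_mul_of_nonneg_left (hp n) (by positivity))
    _ = C * ((((n + 1 : ℕ) : ℝ) + 1) * (γ * ‖y‖) ^ (n + 1)) := by rw [mul_pow]; ring

/-- Majorization of the linearization error `f'(x + y) y - (f(x + y) - f(x))`. -/
theorem norm_fderiv_apply_sub_le_of_hasFPowerSeriesOnBall (hf : HasFPowerSeriesOnBall f p x s)
    (hγ : 0 ≤ γ) (hp : ∀ n, ‖p (n + 2)‖ ≤ C * γ ^ (n + 1)) {y : E}
    (hy : y ∈ Metric.eball (0 : E) s) (hy1 : γ * ‖y‖ < 1) :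
    ‖fderiv 𝕜 f (x + y) y - f (x + y) + f x‖ ≤
      C * ‖y‖ * (γ * ‖y‖ / (1 - γ * ‖y‖) ^ 2) := by
  have hu : ‖γ * ‖y‖‖ < 1 := by rwa [Real.norm_of_nonneg (mul_nonneg hγ (norm_nonneg y))]
  have h0 : f x = p 0 fun _ => y := (hf.coeff_zero _).symm
  have h1 := (hasSum_nat_add_iff' 1).2 (hf.hasSum hy)
  have h2 := (ContinuousLinearMap.apply 𝕜 F y).hasSum (hf.fderiv.hasSum hy)
  have h3 := h2.sub h1
  have h4 := (hasSum_coe_mul_geometric_of_norm_lt_one hu).mul_left (C * ‖y‖)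
  simp only [Finset.sum_range_one, ContinuousLinearMap.apply_apply,
    FormalMultilinearSeries.derivSeries_apply_diag] at h3
  rw [sub_add, h0]
  refine h3.norm_le_of_bounded h4 fun n => ?_
  -- On the diagonal the derivative series has terms (n + 1)pₙ₊₁; subtracting the function leaves n
  -- pₙ₊₁, whence the majorant Σ n uⁿ = u/(1 - u)².
  rw [succ_nsmul, add_sub_cancel_right]
  rcases n with _ | n
  · simp
  refine (norm_nsmul_le).trans ?_
  calc ((n + 1 : ℕ) : ℝ) * ‖p (n + 1 + 1) fun _ => y‖
      ≤ ((n + 1 : ℕ) : ℝ) * (C * γ ^ (n + 1) * ‖y‖ ^ (n + 2)) := by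
        gcongr
        refine ((p (n + 2)).le_opNorm _).trans ?_
        simp only [Finset.prod_const, Finset.card_univ, Fintype.card_fin]
        gcongr
        exact hp n
    _ = C * ‖y‖ * (((n + 1 : ℕ) : ℝ) * (γ * ‖y‖) ^ (n + 1)) := by rw [mul_pow]; ring

end Series

/-! ### Taylor series on a full ball -/

section Taylor

variable {𝕜 E F : Type*} [RCLike 𝕜]
  [NormedAddCommGroup E] [NormedSpace 𝕜 E] [NormedAddCommGroup F] [NormedSpace 𝕜 F]
  [CompleteSpace F]

variable (𝕜) in
/-- The Taylor series of `f` at `x`, with the iterated derivatives as coefficients. -/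
def taylorSeries (f : E → F) (x : E) : FormalMultilinearSeries 𝕜 E F :=
  fun n => (n ! : 𝕜)⁻¹ • iteratedFDeriv 𝕜 n f x

omit [CompleteSpace F] in
theorem norm_taylorSeries (f : E → F) (x : E) (n : ℕ) :
    ‖taylorSeries 𝕜 f x n‖ = ‖iteratedFDeriv 𝕜 n f x‖ / (n ! : ℝ) := by
  rw [taylorSeries, norm_smul, norm_inv, RCLike.norm_natCast, div_eq_inv_mul]

/-- A function analytic on a ball is given there by its Taylor series at the centre, provided
this series converges on the ball. -/
theorem hasFPowerSeriesOnBall_taylorSeries {f : E → F} {x : E} {s : ℝ} (hs : 0 < s)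
    (hf : AnalyticOnNhd 𝕜 f (Metric.ball x s))
    (hrad : ENNReal.ofReal s ≤ (taylorSeries 𝕜 f x).radius) :
    HasFPowerSeriesOnBall f (taylorSeries 𝕜 f x) x (ENNReal.ofReal s) := by
  have hs' : 0 < ENNReal.ofReal s := ENNReal.ofReal_pos.2 hs
  set q := taylorSeries 𝕜 f x
  have h1 : HasFPowerSeriesOnBall (fun z => q.sum (z - x)) q x (ENNReal.ofReal s) := by
    simpa using ((q.hasFPowerSeriesOnBall (hs'.trans_le hrad)).mono hs' hrad).comp_sub x
  obtain ⟨p, ε, hp⟩ := hf x (Metric.mem_ball_self hs)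
  -- The local expansion `p` need not have symmetric coefficients, so it may differ from `q`; the
  -- sums still agree near `x`, and the identity theorem extends this to the ball.
  have hev : f =ᶠ[𝓝 x] fun z => q.sum (z - x) := by
    filter_upwards [Metric.eball_mem_nhds x hp.r_pos] with z hz
    have hz' : z - x ∈ Metric.eball (0 : E) ε := by
      simpa [edist_eq_enorm_sub] using hz
    have h2 := hp.hasSum_iteratedFDeriv hz'
    rw [add_sub_cancel] at h2
    exact h2.tsum_eq.symm
  have hpre : IsPreconnected (Metric.ball x s) := by
    let : NormedSpace ℝ E := NormedSpace.restrictScalars ℝ 𝕜 E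
    exact (convex_ball x s).isPreconnected
  have hball : Metric.eball x (ENNReal.ofReal s) = Metric.ball x s := Metric.eball_ofReal
  have h3 : AnalyticOnNhd 𝕜 (fun z => q.sum (z - x)) (Metric.ball x s) := hball ▸ h1.analyticOnNhd
  have heq := hf.eqOn_of_preconnected_of_eventuallyEq h3 hpre (Metric.mem_ball_self hs) hev
  exact h1.congr fun z hz => (heq (hball ▸ hz)).symm

omit [CompleteSpace F] in
-- Boundedness of ‖pₙ‖sⁿ suffices, so γs = 1 is allowed. The two coefficients outside the hypothesis
-- enter the bound separately.
theorem ofReal_le_radius_of_norm_le {p : FormalMultilinearSeries 𝕜 E F} {C γ s : ℝ} (hC : 0 ≤ C)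
    (hγ : 0 ≤ γ) (hs : 0 ≤ s) (hγs : γ * s ≤ 1) (hp : ∀ n, ‖p (n + 2)‖ ≤ C * γ ^ (n + 1)) :
    ENNReal.ofReal s ≤ p.radius := by
  refine p.le_radius_of_bound (‖p 0‖ + ‖p 1‖ * s + C * s) fun n => ?_
  rw [Real.coe_toNNReal s hs]
  have h1 : 0 ≤ ‖p 1‖ * s := by positivity
  have h2 : 0 ≤ C * s := by positivity
  rcases n with _ | _ | n
  · rw [pow_zero, mul_one]; linarith
  · rw [zero_add, pow_one]; linarith [norm_nonneg (p 0)]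
  · calc ‖p (n + 2)‖ * s ^ (n + 2) ≤ C * γ ^ (n + 1) * s ^ (n + 2) := by gcongr; exact hp n
      _ = C * s * (γ * s) ^ (n + 1) := by rw [mul_pow]; ring
      _ ≤ C * s * 1 := by gcongr; exact pow_le_one₀ (by positivity) hγs
      _ ≤ _ := by linarith [norm_nonneg (p 0)]

/-- Estimates for the derivative and the linearization error of a function analytic on a ball
whose Taylor coefficients at the centre are dominated by a geometric sequence. -/
theorem analytic_estimates_of_norm_taylorSeries_le {f : E → F} {x : E} {δ C γ : ℝ} (hC : 0 ≤ C)
    (hγ : 0 ≤ γ) (hf : AnalyticOnNhd 𝕜 f (Metric.ball x δ))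
    (hp : ∀ n, ‖taylorSeries 𝕜 f x (n + 2)‖ ≤ C * γ ^ (n + 1)) {z : E}
    (hz : ‖z - x‖ < δ) (hz1 : γ * ‖z - x‖ < 1) :
    ‖fderiv 𝕜 f z - fderiv 𝕜 f x‖ ≤ C * (1 / (1 - γ * ‖z - x‖) ^ 2 - 1) ∧
    ‖fderiv 𝕜 f z (z - x) - f z + f x‖ ≤
      C * ‖z - x‖ * (γ * ‖z - x‖ / (1 - γ * ‖z - x‖) ^ 2) := by
  obtain ⟨s, hzs, hsδ, hs1⟩ : ∃ s, ‖z - x‖ < s ∧ s ≤ δ ∧ γ * s ≤ 1 := by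
    rcases hγ.eq_or_lt with rfl | hγ
    · exact ⟨δ, hz, le_rfl, by simp⟩
    · refine ⟨min δ (1 / γ), lt_min hz ?_, min_le_left _ _, ?_⟩
      · rwa [lt_div_iff₀' hγ]
      · rw [← le_div_iff₀' hγ]; exact min_le_right _ _
  have hs : 0 < s := (norm_nonneg _).trans_lt hzs
  have h := hasFPowerSeriesOnBall_taylorSeries hs (hf.mono (Metric.ball_subset_ball hsδ))
    (ofReal_le_radius_of_norm_le hC hγ hs.le hs1 hp)
  have hmem : z - x ∈ Metric.eball (0 : E) (ENNReal.ofReal s) := by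
    rw [Metric.eball_ofReal, mem_ball_zero_iff]
    exact hzs
  have h1 := norm_fderiv_sub_le_of_hasFPowerSeriesOnBall h hγ hp hmem hz1
  have h2 := norm_fderiv_apply_sub_le_of_hasFPowerSeriesOnBall h hγ hp hmem hz1
  rw [add_sub_cancel] at h1 h2
  exact ⟨h1, h2⟩

end Taylor

/-! ### Monotonicity of the contraction factor -/

section Scalar

/-- Cross-multiplied form of the decrease of (1 + w)/(2w² - 1) where the denominator is positive;
the difference of the sides is (w - s)(2(w + s) + 2sw + 1). -/
theorem one_add_mul_two_sq_sub_le {s w : ℝ} (hs : 0 ≤ s) (hsw : s ≤ w) :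
    (1 + w) * (2 * s ^ 2 - 1) ≤ (1 + s) * (2 * w ^ 2 - 1) := by
  nlinarith [mul_nonneg (sub_nonneg.2 hsw) (mul_nonneg hs (hs.trans hsw)),
    mul_nonneg (sub_nonneg.2 hsw) (add_nonneg hs (hs.trans hsw)), sub_nonneg.2 hsw]

theorem sq_mul_two_sq_sub_le {s w : ℝ} (hs : 0 ≤ s) (hsw : s ≤ w) :
    w ^ 2 * (2 * s ^ 2 - 1) ≤ s ^ 2 * (2 * w ^ 2 - 1) := by
  nlinarith [pow_le_pow_left₀ hs hsw 2]

/-- Numerator of the contraction factor at `w = 1 - γ σ`. -/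
def rateNumerator (κ a b w : ℝ) : ℝ :=
  (1 - w) * (1 + (κ - 1) * w ^ 2) + b * (1 - w) * (1 + w) ^ 2 + (b * κ + a) * (1 + w) * w ^ 2

theorem polynomial_eq_rateNumerator_sub (κ a b s : ℝ) :
    -4 * s ^ 4 + (1 - κ + a + b * (κ - 1)) * s ^ 3 + (3 + κ + a + b * (κ - 1)) * s ^ 2
      + (b - 1) * s + b = rateNumerator κ a b s - (2 * s ^ 2 - 1) ^ 2 := by
  unfold rateNumerator; ring

/-- The contraction factor `rateNumerator κ a b w / (2 w² - 1)²` decreases in `w`. -/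
theorem rateNumerator_lt_of_le {κ a b s w : ℝ} (hκ : 1 ≤ κ) (ha : 0 ≤ a) (hb : 0 ≤ b)
    (hs : 0 ≤ s) (hs2 : 0 < 2 * s ^ 2 - 1) (hsw : s ≤ w) (hw : w ≤ 1)
    (h : rateNumerator κ a b s < (2 * s ^ 2 - 1) ^ 2) :
    rateNumerator κ a b w < (2 * w ^ 2 - 1) ^ 2 := by
  have hsq := pow_le_pow_left₀ hs hsw 2
  have hw0 := hs.trans hsw
  have hDw : 0 < 2 * w ^ 2 - 1 := by linarith
  set Ds := 2 * s ^ 2 - 1 with hDs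
  set Dw := 2 * w ^ 2 - 1 with hDw'
  -- Each summand of the numerator splits into two nonnegative factors, for instance (1 - w)(1 + w)²
  -- = (1 - w²)(1 + w), and each factor decreases after division by 2w² - 1.
  have h1 : (1 + w) * Ds ≤ (1 + s) * Dw := one_add_mul_two_sq_sub_le hs hsw
  have h2 : w ^ 2 * Ds ≤ s ^ 2 * Dw := sq_mul_two_sq_sub_le hs hsw
  have hD : Ds ≤ Dw := by linarith
  have h3 : (1 - w) * Ds ≤ (1 - s) * Dw :=
    mul_le_mul (by linarith) hD hs2.le (by linarith)
  have h4 : (1 + (κ - 1) * w ^ 2) * Ds ≤ (1 + (κ - 1) * s ^ 2) * Dw := by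
    have := mul_le_mul_of_nonneg_left h2 (sub_nonneg.2 hκ)
    linarith
  have h5 : (1 - w ^ 2) * Ds ≤ (1 - s ^ 2) * Dw :=
    mul_le_mul (by linarith) hD hs2.le (by nlinarith)
  have hw1 : 0 ≤ 1 - w := by linarith
  have hw2 : 0 ≤ 1 - w ^ 2 := by nlinarith
  have hκ1 : 0 ≤ κ - 1 := by linarith
  have hs1 : 0 ≤ 1 - s := by linarith
  have hss : 0 ≤ 1 - s ^ 2 := by nlinarith
  have e1 : (1 - w) * Ds * ((1 + (κ - 1) * w ^ 2) * Ds) ≤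
      (1 - s) * Dw * ((1 + (κ - 1) * s ^ 2) * Dw) :=
    mul_le_mul h3 h4 (by positivity) (by positivity)
  have e2 : (1 - w ^ 2) * Ds * ((1 + w) * Ds) ≤ (1 - s ^ 2) * Dw * ((1 + s) * Dw) :=
    mul_le_mul h5 h1 (by positivity) (by positivity)
  have e3 : (1 + w) * Ds * (w ^ 2 * Ds) ≤ (1 + s) * Dw * (s ^ 2 * Dw) :=
    mul_le_mul h1 h2 (by positivity) (by positivity)
  have e2' := mul_le_mul_of_nonneg_left e2 hb
  have e3' := mul_le_mul_of_nonneg_left e3 (by positivity : 0 ≤ b * κ + a)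
  have hN : rateNumerator κ a b w * Ds ^ 2 ≤ rateNumerator κ a b s * Dw ^ 2 := by
    unfold rateNumerator
    linarith
  have hlt : rateNumerator κ a b s * Dw ^ 2 < Ds ^ 2 * Dw ^ 2 :=
    mul_lt_mul_of_pos_right h (by positivity)
  have : rateNumerator κ a b w * Ds ^ 2 < Dw ^ 2 * Ds ^ 2 := by linarith
  exact lt_of_mul_lt_mul_right this (by positivity)

theorem two_sq_sub_one_pos {s : ℝ} (hs : √2 / 2 < s) : 0 < 2 * s ^ 2 - 1 := by
  have h2 : √2 ^ 2 = 2 := Real.sq_sqrt (by norm_num)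
  have h : (√2 / 2) ^ 2 < s ^ 2 := pow_lt_pow_left₀ hs (by positivity) two_ne_zero
  rw [div_pow, h2] at h
  linarith

/-- The set defining the critical radius is nonempty when the polynomial is negative at `1`. -/
theorem exists_mem_Ioo_rateNumerator_lt {κ a b : ℝ} (h1 : 2 * (b * κ + a) < 1) :
    ∃ s ∈ Set.Ioo (√2 / 2) 1, rateNumerator κ a b s < (2 * s ^ 2 - 1) ^ 2 := by
  have hlt : √2 / 2 < 1 := by
    rw [div_lt_one two_pos, Real.sqrt_lt' two_pos]
    norm_num
  have hc : Continuous fun s : ℝ => rateNumerator κ a b s - (2 * s ^ 2 - 1) ^ 2 := by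
    unfold rateNumerator; fun_prop
  -- The numerator at 1 is 2(bκ + a), which is h for the `a` and `b` of the theorem.
  have hneg : rateNumerator κ a b 1 - (2 * 1 ^ 2 - 1) ^ 2 < 0 := by
    unfold rateNumerator
    linarith
  have h2 : ∀ᶠ s in 𝓝[<] (1 : ℝ), rateNumerator κ a b s - (2 * s ^ 2 - 1) ^ 2 < 0 :=
    ((hc.tendsto 1).eventually_lt_const hneg).filter_mono nhdsWithin_le_nhds
  obtain ⟨s, hs, hs'⟩ := (h2.and (Ioo_mem_nhdsLT hlt)).exists
  exact ⟨s, hs', sub_neg.1 hs⟩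

/-- The bound of the proximal Gauss-Newton step at distance `σ` from the solution, with
coefficients evaluated at `w`. -/
def stepBound (β c γ κ w σ : ℝ) : ℝ :=
  γ * (1 + (κ - 1) * w ^ 2) / (1 - 2 * w ^ 2) ^ 2 * σ ^ 2
    + (1 + √2) * β * c * γ ^ 2 * (1 + w) ^ 2 / (1 - 2 * w ^ 2) ^ 2 * σ ^ 2
    + c * β * γ * ((1 + √2) * κ + 1) * (1 + w) * w ^ 2 / (1 - 2 * w ^ 2) ^ 2 * σ

/-- In the terms quadratic in σ, one factor γσ is replaced by 1 - w; the last term is already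
linear. -/
theorem stepBound_le {β c γ κ w σ : ℝ} (hβ : 0 ≤ β) (hc : 0 ≤ c) (hκ : 1 ≤ κ) (hw : 0 ≤ w)
    (hγ : 0 ≤ γ) (hσ : 0 ≤ σ) (hγσ : γ * σ ≤ 1 - w) :
    stepBound β c γ κ w σ ≤
      rateNumerator κ (γ * c * β) ((1 + √2) * γ * c * β) w / (2 * w ^ 2 - 1) ^ 2 * σ := by
  have hκ1 : 0 ≤ κ - 1 := by linarith
  calc stepBound β c γ κ w σ
      = (γ * σ * (1 + (κ - 1) * w ^ 2) + (1 + √2) * γ * c * β * (γ * σ) * (1 + w) ^ 2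
          + ((1 + √2) * γ * c * β * κ + γ * c * β) * (1 + w) * w ^ 2)
          / (2 * w ^ 2 - 1) ^ 2 * σ := by
        rw [stepBound, show (1 - 2 * w ^ 2) ^ 2 = (2 * w ^ 2 - 1) ^ 2 by ring]
        ring
    _ ≤ _ := by
        unfold rateNumerator
        gcongr

/-- The left side is what the argument yields at the current iterate; `w₀` belongs to the starting
point. The first terms compare because 0 < 2w₀² - 1 ≤ 1, the others because (1 + w)w²/(2w² - 1)²
decreases and (1 + √2)κ + 1 ≥ 1. The middle term of `stepBound` is slack. -/
theorem le_stepBound {β c γ κ w₀ w σ : ℝ} (hβ : 0 ≤ β) (hc : 0 ≤ c) (hγ : 0 ≤ γ) (hκ : 1 ≤ κ)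
    (hσ : 0 ≤ σ) (hw₀ : 0 ≤ w₀) (hD : 0 < 2 * w₀ ^ 2 - 1) (hw : w₀ ≤ w) (hw1 : w ≤ 1) :
    γ * σ ^ 2 / (2 * w ^ 2 - 1) + c * β * γ * σ * ((1 + w) * w ^ 2) / (2 * w ^ 2 - 1) ^ 2 ≤
      stepBound β c γ κ w₀ σ := by
  have hsq := pow_le_pow_left₀ hw₀ hw 2
  have hDw : 0 < 2 * w ^ 2 - 1 := by linarith
  have hκ1 : 0 ≤ κ - 1 := by linarith
  have h1 := one_add_mul_two_sq_sub_le hw₀ hw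
  have h2 := sq_mul_two_sq_sub_le hw₀ hw
  have hw' := hw₀.trans hw
  have e1 : γ * σ ^ 2 / (2 * w ^ 2 - 1) ≤
      γ * (1 + (κ - 1) * w₀ ^ 2) / (1 - 2 * w₀ ^ 2) ^ 2 * σ ^ 2 := by
    rw [div_mul_eq_mul_div, show (1 - 2 * w₀ ^ 2) ^ 2 = (2 * w₀ ^ 2 - 1) ^ 2 by ring]
    refine div_le_div₀ (by positivity) ?_ (by positivity) ?_
    · have : 0 ≤ γ * ((κ - 1) * w₀ ^ 2) * σ ^ 2 := by positivity
      linarith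
    · have : w₀ ^ 2 ≤ 1 := pow_le_one₀ hw₀ (hw.trans hw1)
      nlinarith
  have e2 : c * β * γ * σ * ((1 + w) * w ^ 2) / (2 * w ^ 2 - 1) ^ 2 ≤
      c * β * γ * ((1 + √2) * κ + 1) * (1 + w₀) * w₀ ^ 2 / (1 - 2 * w₀ ^ 2) ^ 2 * σ := by
    have h3 : (1 + w) * w ^ 2 / (2 * w ^ 2 - 1) ^ 2 ≤
        (1 + w₀) * w₀ ^ 2 / (2 * w₀ ^ 2 - 1) ^ 2 := by
      rw [div_le_div_iff₀ (by positivity) (by positivity)]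
      have := mul_le_mul h1 h2 (by positivity) (by positivity)
      linarith
    calc c * β * γ * σ * ((1 + w) * w ^ 2) / (2 * w ^ 2 - 1) ^ 2
        = c * β * γ * σ * 1 * ((1 + w) * w ^ 2 / (2 * w ^ 2 - 1) ^ 2) := by ring
      _ ≤ c * β * γ * σ * ((1 + √2) * κ + 1) *
          ((1 + w₀) * w₀ ^ 2 / (2 * w₀ ^ 2 - 1) ^ 2) := by
        gcongr
        have : 0 ≤ (1 + √2) * κ := by positivity
        linarith
      _ = _ := by rw [show (1 - 2 * w₀ ^ 2) ^ 2 = (2 * w₀ ^ 2 - 1) ^ 2 by ring]; ring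
  have e3 : 0 ≤ (1 + √2) * β * c * γ ^ 2 * (1 + w₀) ^ 2 / (1 - 2 * w₀ ^ 2) ^ 2 * σ ^ 2 := by
    positivity
  unfold stepBound
  linarith

end Scalar

/-! ### One proximal Gauss–Newton step -/

section Step

variable {𝕜 X Y : Type*} [RCLike 𝕜]
  [NormedAddCommGroup X] [InnerProductSpace 𝕜 X] [CompleteSpace X]
  [NormedAddCommGroup Y] [InnerProductSpace 𝕜 Y] [CompleteSpace Y]

/-- The distance estimate following from the variational inequality of a proximal Gauss-Newton
step. -/
theorem norm_le_of_variational_inequality {A A₀ : X →L[𝕜] Y} {B : Y →L[𝕜] X}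
    (hAB : IsMoorePenrose A B) {x x₀ e : X} {f f₀ : Y} {M : ℝ} (hM0 : 0 ≤ M)
    (hM : ∀ x, ‖x‖ ≤ M * ‖A x‖)
    (h : ‖A e‖ ^ 2 ≤ -RCLike.re (inner 𝕜 (-(ContinuousLinearMap.adjoint A₀ f₀)) e)
      - RCLike.re (inner 𝕜 (A e) (A (x₀ - (x - B f))))) :
    ‖e‖ ≤ M * ‖A (x - x₀) - f + f₀‖ + M ^ 2 * ‖A - A₀‖ * ‖f₀‖ := by
  have h1 : RCLike.re (inner 𝕜 (A e) (A (x₀ - (x - B f)))) =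
      -RCLike.re (inner 𝕜 (A e) (A (x - x₀) - f)) := by
    have : A (x₀ - (x - B f)) = -A (x - x₀) + A (B f) := by
      rw [← map_neg, ← map_add]; congr 1; abel
    rw [this, inner_add_right, hAB.inner_apply_comp, inner_neg_right, inner_sub_right]
    simp only [map_add, map_neg, map_sub]
    ring
  -- Writing A₀ = A - (A - A₀) lets f₀ join the linearization error, at the cost of one term in A -
  -- A₀.
  have h2 : RCLike.re (inner 𝕜 (ContinuousLinearMap.adjoint A₀ f₀) e) =
      RCLike.re (inner 𝕜 (A e) f₀) - RCLike.re (inner 𝕜 ((A - A₀) e) f₀) := by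
    rw [ContinuousLinearMap.adjoint_inner_left, ← inner_re_symm, sub_apply,
      inner_sub_left, map_sub, sub_sub_cancel]
  have h3 : RCLike.re (inner 𝕜 (A e) (A (x - x₀) - f + f₀)) ≤
      ‖A e‖ * ‖A (x - x₀) - f + f₀‖ := re_inner_le_norm _ _
  have h4 : -RCLike.re (inner 𝕜 ((A - A₀) e) f₀) ≤ ‖A - A₀‖ * (M * ‖A e‖) * ‖f₀‖ := by
    have := (abs_le.1 ((RCLike.abs_re_le_norm _).trans (norm_inner_le_norm (𝕜 := 𝕜)
      ((A - A₀) e) f₀))).1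
    have h5 : ‖(A - A₀) e‖ ≤ ‖A - A₀‖ * (M * ‖A e‖) :=
      ((A - A₀).le_opNorm e).trans (mul_le_mul_of_nonneg_left (hM e) (norm_nonneg _))
    have := mul_le_mul_of_nonneg_right h5 (norm_nonneg f₀)
    linarith
  rw [inner_add_right, map_add] at h3
  rw [h1, inner_neg_left, map_neg, h2] at h
  have h6 : ‖A e‖ ^ 2 ≤
      ‖A e‖ * (‖A (x - x₀) - f + f₀‖ + M * ‖A - A₀‖ * ‖f₀‖) := by linarith
  have h7 : ‖A e‖ ≤ ‖A (x - x₀) - f + f₀‖ + M * ‖A - A₀‖ * ‖f₀‖ := by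
    rcases (norm_nonneg (A e)).eq_or_lt with h0 | h0
    · rw [← h0]; positivity
    · exact le_of_mul_le_mul_left (by rwa [← sq]) h0
  calc ‖e‖ ≤ M * ‖A e‖ := hM e
    _ ≤ M * (‖A (x - x₀) - f + f₀‖ + M * ‖A - A₀‖ * ‖f₀‖) := by gcongr
    _ = _ := by ring

/-- Existence of the proximal Gauss-Newton step at `x` and its error bound. -/
theorem exists_isProxGNStep {Ω : Set X} (hΩ : IsOpen Ω) {J : X → EReal}
    (hJ : IsProperConvex 𝕜 J) (hJlsc : LowerSemicontinuousOn J Ω) {F : X → Y}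
    (hF : AnalyticOnNhd 𝕜 F Ω) (hclosed : ∀ x ∈ Ω, IsClosed (Set.range (fderiv 𝕜 F x)))
    {xs : X} {β γ κ δ σ₀ : ℝ} (hβ : 0 < β) (hγ : 0 ≤ γ) (hκ : 1 ≤ κ)
    (hstat : -(ContinuousLinearMap.adjoint (fderiv 𝕜 F xs) (F xs)) ∈ subdifferential 𝕜 J xs)
    (hbelow : ∀ u, ‖u‖ ≤ β * ‖fderiv 𝕜 F xs u‖)
    (hcoeff : ∀ n, ‖taylorSeries 𝕜 F xs (n + 2)‖ ≤ 1 / β * γ ^ (n + 1))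
    (hball : Metric.ball xs δ ⊆ Ω) (hσδ : σ₀ < δ) (hw : 0 < 1 - γ * σ₀)
    (hD : 0 < 2 * (1 - γ * σ₀) ^ 2 - 1)
    (hbound : stepBound β ‖F xs‖ γ κ (1 - γ * σ₀) σ₀ ≤ σ₀)
    {x : X} (hx : ‖x - xs‖ ≤ σ₀) :
    ∃ x', IsProxGNStep 𝕜 Ω F J x x' ∧
      ‖x' - xs‖ ≤ stepBound β ‖F xs‖ γ κ (1 - γ * σ₀) ‖x - xs‖ := by
  have hxδ : ‖x - xs‖ < δ := hx.trans_lt hσδ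
  have hxΩ : x ∈ Ω := hball (mem_ball_iff_norm.2 hxδ)
  set A := fderiv 𝕜 F x with hA
  set A₀ := fderiv 𝕜 F xs with hA₀
  set σ := ‖x - xs‖ with hσ
  have hσ0 : 0 ≤ σ := norm_nonneg _
  set w := 1 - γ * σ with hw_def
  have hγσ0 : 0 ≤ γ * σ := mul_nonneg hγ hσ0
  have hww : 1 - γ * σ₀ ≤ w := by
    have := mul_le_mul_of_nonneg_left hx hγ
    linarith
  have hwpos : 0 < w := hw.trans_le hww
  have hw1 : w ≤ 1 := by linarith
  have hDw : 0 < 2 * w ^ 2 - 1 := by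
    have := pow_le_pow_left₀ hw.le hww 2
    linarith
  obtain ⟨hη, hL⟩ := analytic_estimates_of_norm_taylorSeries_le (one_div_nonneg.2 hβ.le) hγ
    (hF.mono hball) hcoeff hxδ (by linarith)
  rw [← hA, ← hA₀, ← hσ, ← hw_def] at hη
  rw [← hA, ← hσ, ← hw_def] at hL
  set M := β * w ^ 2 / (2 * w ^ 2 - 1) with hM_def
  have hM0 : 0 ≤ M := by positivity
  -- Since β‖A - A₀‖ ≤ 1/w² - 1, absorbing the perturbation leaves the factor 1 - (1/w² - 1) = (2w²
  -- - 1)/w², which is positive by `hDw`.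
  have hM : ∀ u, ‖u‖ ≤ M * ‖A u‖ := by
    intro u
    have h1 : ‖A₀ u‖ ≤ ‖A u‖ + 1 / β * (1 / w ^ 2 - 1) * ‖u‖ := by
      have h2 : A₀ u = A u - (A - A₀) u := by simp
      rw [h2]
      refine (norm_sub_le _ _).trans ?_
      gcongr
      exact (A - A₀).le_of_opNorm_le hη u
    have h3 := (hbelow u).trans (mul_le_mul_of_nonneg_left h1 hβ.le)
    have h4 : β * (‖A u‖ + 1 / β * (1 / w ^ 2 - 1) * ‖u‖) =
        β * ‖A u‖ + (1 / w ^ 2 - 1) * ‖u‖ := by field_simp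
    rw [h4] at h3
    rw [hM_def, div_mul_eq_mul_div, le_div_iff₀ hDw]
    have h5 := mul_le_mul_of_nonneg_right h3 (sq_nonneg w)
    have h6 : (β * ‖A u‖ + (1 / w ^ 2 - 1) * ‖u‖) * w ^ 2 =
        β * ‖A u‖ * w ^ 2 + (1 - w ^ 2) * ‖u‖ := by field_simp
    linarith
  have hinj : Function.Injective A := by
    refine (injective_iff_map_eq_zero A).2 fun u hu => norm_le_zero_iff.1 ?_
    simpa [hu] using hM u
  have hmp := isMoorePenrose_pinv A hinj (hclosed x hxΩ)
  obtain ⟨p, hprox, hvar⟩ := exists_isProx_of_lowerSemicontinuousAt hJ hstat A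
    (x - pinv A (F x)) hM
  have hnorm := norm_le_of_variational_inequality hmp hM0 hM hvar
  have hle : ‖p - xs‖ ≤ stepBound β ‖F xs‖ γ κ (1 - γ * σ₀) σ := by
    refine hnorm.trans (le_trans ?_
      (le_stepBound hβ.le (norm_nonneg (F xs)) hγ hκ hσ0 hw.le hD hww hw1))
    have h1 := mul_le_mul_of_nonneg_left hL hM0
    have h2 := mul_le_mul_of_nonneg_right (mul_le_mul_of_nonneg_left hη (sq_nonneg M))
      (norm_nonneg (F xs))
    have e1 : M * (1 / β * σ * (γ * σ / w ^ 2)) = γ * σ ^ 2 / (2 * w ^ 2 - 1) := by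
      rw [hM_def]; field_simp
    have e2 : M ^ 2 * (1 / β * (1 / w ^ 2 - 1)) * ‖F xs‖ =
        ‖F xs‖ * β * γ * σ * ((1 + w) * w ^ 2) / (2 * w ^ 2 - 1) ^ 2 := by
      have : γ * σ = 1 - w := by rw [hw_def]; ring
      rw [mul_assoc (‖F xs‖ * β), this, hM_def]
      field_simp
      ring
    rw [e1] at h1
    rw [e2] at h2
    exact add_le_add h1 h2
  -- The error bound holds before `p` is known to be a minimizer; it places `p` in Ω, where
  -- semicontinuity is available.
  have hpΩ : p ∈ Ω := by
    refine hball (mem_ball_iff_norm.2 ((hle.trans ?_).trans_lt hσδ))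
    refine le_trans ?_ hbound
    have hκ1 : 0 ≤ κ - 1 := by linarith
    unfold stepBound
    gcongr
  have hlsc : LowerSemicontinuousAt J p := fun y hy => by
    have := hJlsc p hpΩ y hy
    rwa [hΩ.nhdsWithin_eq hpΩ] at this
  exact ⟨p, ⟨hxΩ, hmp, hmp.isUnit_adjoint_comp hinj, hprox hlsc⟩, hle⟩

end Step

/-! ### Radii, Taylor coefficients and iteration -/

/-- The open ball of radius `sup {t ∈ [0, R) : B(x, t) ⊆ Ω}` is contained in `Ω`. -/
theorem ball_sSup_subset {X : Type*} [PseudoMetricSpace X] (Ω : Set X) (x : X) {R : ℝ}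
    (hR : 0 < R) : Metric.ball x (sSup {t : ℝ | t ∈ Set.Ico 0 R ∧ Metric.ball x t ⊆ Ω}) ⊆ Ω := by
  intro z hz
  have hne : {t : ℝ | t ∈ Set.Ico 0 R ∧ Metric.ball x t ⊆ Ω}.Nonempty :=
    ⟨0, ⟨le_rfl, hR⟩, by simp⟩
  obtain ⟨t, ht, hzt⟩ := exists_lt_of_lt_csSup hne (Metric.mem_ball.1 hz)
  exact ht.2 (Metric.mem_ball.2 hzt)

/-- Taking powers undoes the roots in the definition of γ; the index n + 2 turns the exponent into
1/(n + 1). -/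
theorem nonneg_and_norm_taylorSeries_le_of_isLUB {𝕜 E F : Type*} [RCLike 𝕜]
    [NormedAddCommGroup E] [NormedSpace 𝕜 E] [NormedAddCommGroup F] [NormedSpace 𝕜 F]
    {f : E → F} {x : E} {β γ : ℝ} (hβ : 0 < β)
    (hγ : IsLUB {t : ℝ | ∃ n : ℕ, 1 < n ∧
      t = (β * (‖iteratedFDeriv 𝕜 n f x‖ / (n ! : ℝ))) ^ ((1 : ℝ) / ((n : ℝ) - 1))} γ) :
    0 ≤ γ ∧ ∀ n, ‖taylorSeries 𝕜 f x (n + 2)‖ ≤ 1 / β * γ ^ (n + 1) := by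
  have h (n : ℕ) : (β * ‖taylorSeries 𝕜 f x (n + 2)‖) ^ ((n + 1 : ℕ) : ℝ)⁻¹ ≤ γ := by
    refine hγ.1 ⟨n + 2, by omega, ?_⟩
    rw [norm_taylorSeries, one_div]
    congr 2
    push_cast
    ring
  refine ⟨le_trans (by positivity) (h 0), fun n => ?_⟩
  have h1 := pow_le_pow_left₀ (by positivity) (h n) (n + 1)
  rw [Real.rpow_inv_natCast_pow (by positivity) n.succ_ne_zero] at h1
  rwa [one_div, ← div_eq_inv_mul, le_div_iff₀' hβ]

/-- A relation that can be iterated inside a ball, contracting the distance to the centre, has an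
orbit from every point of the ball, and the orbit converges to the centre. -/
theorem exists_orbit_tendsto {X : Type*} [NormedAddCommGroup X] {step : X → X → Prop}
    {bound : ℝ → ℝ} {xs x₀ : X} {θ : ℝ} (hθ0 : 0 ≤ θ) (hθ1 : θ < 1)
    (hstep : ∀ x, ‖x - xs‖ ≤ ‖x₀ - xs‖ → ∃ x', step x x' ∧ ‖x' - xs‖ ≤ bound ‖x - xs‖)
    (hbound : ∀ σ, 0 ≤ σ → σ ≤ ‖x₀ - xs‖ → bound σ ≤ θ * σ) :
    ∃ x : ℕ → X, x 0 = x₀ ∧ (∀ k, step (x k) (x (k + 1))) ∧ (∀ k, ‖x k - xs‖ ≤ ‖x₀ - xs‖) ∧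
      Tendsto x atTop (𝓝 xs) ∧ ∀ k, ‖x (k + 1) - xs‖ ≤ bound ‖x k - xs‖ := by
  choose! g hg hgb using hstep
  have hcontr : ∀ z, ‖z - xs‖ ≤ ‖x₀ - xs‖ → ‖g z - xs‖ ≤ θ * ‖z - xs‖ := fun z hz =>
    (hgb z hz).trans (hbound _ (norm_nonneg _) hz)
  have hgeom : ∀ k, ‖g^[k] x₀ - xs‖ ≤ θ ^ k * ‖x₀ - xs‖ := by
    intro k
    induction k with
    | zero => simp
    | succ k ih =>
      have hk : ‖g^[k] x₀ - xs‖ ≤ ‖x₀ - xs‖ :=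
        ih.trans (mul_le_of_le_one_left (norm_nonneg _) (pow_le_one₀ hθ0 hθ1.le))
      rw [Function.iterate_succ_apply', pow_succ', mul_assoc]
      exact (hcontr _ hk).trans (mul_le_mul_of_nonneg_left ih hθ0)
  have hle : ∀ k, ‖g^[k] x₀ - xs‖ ≤ ‖x₀ - xs‖ := fun k =>
    (hgeom k).trans (mul_le_of_le_one_left (norm_nonneg _) (pow_le_one₀ hθ0 hθ1.le))
  refine ⟨fun k => g^[k] x₀, rfl, fun k => ?_, hle, ?_, fun k => ?_⟩
  · simp only [Function.iterate_succ_apply']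
    exact hg _ (hle k)
  · rw [tendsto_iff_norm_sub_tendsto_zero]
    refine squeeze_zero (fun _ => norm_nonneg _) hgeom ?_
    simpa using (tendsto_pow_atTop_nhds_zero_of_lt_one hθ0 hθ1).mul_const ‖x₀ - xs‖
  · simp only [Function.iterate_succ_apply']
    exact hgb _ (hle k)

/-- For `γ σ` below the critical threshold the contraction factor is less than one. -/
theorem rateNumerator_lt_of_lt_critical {κ a b γ δ σ ρ r : ℝ} (hκ : 1 ≤ κ) (ha : 0 ≤ a)
    (hb : 0 ≤ b) (hγ : 0 ≤ γ) (hσ : 0 < σ) (h1 : 2 * (b * κ + a) < 1)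
    (hρ : ρ = sInf {s : ℝ | s ∈ Set.Ioo (√2 / 2) 1 ∧
      -4 * s ^ 4 + (1 - κ + a + b * (κ - 1)) * s ^ 3 + (3 + κ + a + b * (κ - 1)) * s ^ 2
        + (b - 1) * s + b < 0})
    (hr : r = if γ = 0 then δ else min ((1 - ρ) / γ) δ) (hσr : σ < r) :
    √2 / 2 < 1 - γ * σ ∧
      rateNumerator κ a b (1 - γ * σ) < (2 * (1 - γ * σ) ^ 2 - 1) ^ 2 := by
  simp only [polynomial_eq_rateNumerator_sub, sub_neg] at hρ
  -- The polynomial is not known to be negative on all of (ρ, 1). It suffices to find one `s` of the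
  -- set below 1 - γσ and use monotonicity of the factor; for γ = 0 any `s` of the set will do.
  obtain ⟨s, ⟨hs, hlt⟩, hsw⟩ : ∃ s, (s ∈ Set.Ioo (√2 / 2) 1 ∧
      rateNumerator κ a b s < (2 * s ^ 2 - 1) ^ 2) ∧ s ≤ 1 - γ * σ := by
    obtain ⟨s, hs, hlt⟩ := exists_mem_Ioo_rateNumerator_lt h1
    rcases hγ.eq_or_lt with rfl | hγ
    · exact ⟨s, ⟨hs, hlt⟩, by linarith [hs.2]⟩
    · rw [if_neg hγ.ne'] at hr
      have h2 : σ < (1 - ρ) / γ := hσr.trans_le (hr.trans_le (min_le_left _ _))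
      rw [lt_div_iff₀' hγ] at h2
      have h3 : ρ < 1 - γ * σ := by linarith
      rw [hρ] at h3
      have hne : {s : ℝ | s ∈ Set.Ioo (√2 / 2) 1 ∧
          rateNumerator κ a b s < (2 * s ^ 2 - 1) ^ 2}.Nonempty := ⟨s, hs, hlt⟩
      obtain ⟨t, ht, htw⟩ := exists_lt_of_csInf_lt hne h3
      exact ⟨t, ht, htw.le⟩
  have hs0 : 0 ≤ s := le_trans (by positivity) hs.1.le
  have hγσ : 0 ≤ γ * σ := by positivity
  exact ⟨hs.1.trans_le hsw, rateNumerator_lt_of_le hκ ha hb hs0 (two_sq_sub_one_pos hs.1) hsw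
    (by linarith) hlt⟩

end ProxGN

end

/-! ### Assembly of the convergence theorem -/

theorem theorem4p5 {𝕜 X Y : Type*} [RCLike 𝕜]
    [NormedAddCommGroup X] [InnerProductSpace 𝕜 X] [CompleteSpace X]
    [NormedAddCommGroup Y] [InnerProductSpace 𝕜 Y] [CompleteSpace Y]
    (Ω : Set X) (hΩ : IsOpen Ω)
    (J : X → EReal) (hJ : ProxGN.IsProperConvex 𝕜 J) (hJlsc : LowerSemicontinuousOn J Ω)
    (F : X → Y) (hF : AnalyticOnNhd 𝕜 F Ω)
    (hclosed : ∀ x ∈ Ω, IsClosed (Set.range (fderiv 𝕜 F x)))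
    (xs : X) (hxs : xs ∈ Ω) (R : ℝ) (hR : 0 < R)
    (c β κ δ γ a b ρ r : ℝ)
    (hc : c = ‖F xs‖)
    (hβ : β = ‖ProxGN.pinv (fderiv 𝕜 F xs)‖)
    (hκ : κ = β * ‖fderiv 𝕜 F xs‖)
    (hδ : δ = sSup {t : ℝ | t ∈ Set.Ico 0 R ∧ Metric.ball xs t ⊆ Ω})
    (hstat : -(ContinuousLinearMap.adjoint (fderiv 𝕜 F xs) (F xs)) ∈
      ProxGN.subdifferential 𝕜 J xs)
    (hinj : Function.Injective (fderiv 𝕜 F xs))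
    (hγ : IsLUB {t : ℝ | ∃ n : ℕ, 1 < n ∧
      t = (β * (‖iteratedFDeriv 𝕜 n F xs‖ / (n ! : ℝ))) ^ ((1 : ℝ) / ((n : ℝ) - 1))} γ)
    (hh : 2 * c * γ * β * ((1 + √2) * κ + 1) < 1)
    (ha : a = γ * c * β)
    (hb : b = (1 + √2) * γ * c * β)
    (hρ : ρ = sInf {s : ℝ | s ∈ Set.Ioo (√2 / 2) 1 ∧
      -4 * s ^ 4 + (1 - κ + a + b * (κ - 1)) * s ^ 3 + (3 + κ + a + b * (κ - 1)) * s ^ 2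
        + (b - 1) * s + b < 0})
    (hr : r = if γ = 0 then δ else min ((1 - ρ) / γ) δ)
    (x₀ : X) (hx₀ : x₀ ∈ Metric.ball xs r) (hx₀ne : x₀ ≠ xs) :
    ∃ x : ℕ → X, x 0 = x₀ ∧
      (∀ k, ProxGN.IsProxGNStep 𝕜 Ω F J (x k) (x (k + 1))) ∧
      (∀ k, x k ∈ Metric.ball xs r) ∧
      Tendsto x atTop (𝓝 xs) ∧
      ∀ k, ‖x (k + 1) - xs‖ ≤
        γ * (1 + (κ - 1) * (1 - γ * ‖x₀ - xs‖) ^ 2) /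
            (1 - 2 * (1 - γ * ‖x₀ - xs‖) ^ 2) ^ 2 * ‖x k - xs‖ ^ 2
        + (1 + √2) * β * c * γ ^ 2 * (2 - γ * ‖x₀ - xs‖) ^ 2 /
            (1 - 2 * (1 - γ * ‖x₀ - xs‖) ^ 2) ^ 2 * ‖x k - xs‖ ^ 2
        + c * β * γ * ((1 + √2) * κ + 1) * (2 - γ * ‖x₀ - xs‖) * (1 - γ * ‖x₀ - xs‖) ^ 2 /
            (1 - 2 * (1 - γ * ‖x₀ - xs‖) ^ 2) ^ 2 * ‖x k - xs‖ := by
  have hmp := ProxGN.isMoorePenrose_pinv _ hinj (hclosed xs hxs)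
  have hbelow := hmp.norm_le hinj
  rw [← hβ] at hbelow
  -- The nonzero vector x₀ - x⋆ makes `X` nontrivial, which is what gives β > 0 and κ ≥ 1.
  have hσ : 0 < ‖x₀ - xs‖ := norm_pos_iff.2 (sub_ne_zero.2 hx₀ne)
  have hβ0 : 0 < β := pos_of_mul_pos_left (hσ.trans_le (hbelow _)) (norm_nonneg _)
  have hκ1 : 1 ≤ κ := by
    have h1 := (hbelow (x₀ - xs)).trans
      (mul_le_mul_of_nonneg_left ((fderiv 𝕜 F xs).le_opNorm (x₀ - xs)) hβ0.le)
    rw [← mul_assoc, ← hκ] at h1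
    exact (le_mul_iff_one_le_left hσ).1 h1
  obtain ⟨hγ0, hcoeff⟩ := ProxGN.nonneg_and_norm_taylorSeries_le_of_isLUB hβ0 hγ
  have hc0 : 0 ≤ c := hc ▸ norm_nonneg _
  have hx₀r : ‖x₀ - xs‖ < r := mem_ball_iff_norm.1 hx₀
  have hrδ : r ≤ δ := by
    rw [hr]
    split_ifs
    exacts [le_rfl, min_le_right _ _]
  obtain ⟨hw, hlt⟩ := ProxGN.rateNumerator_lt_of_lt_critical (a := a) (b := b) hκ1
    (by rw [ha]; positivity) (by rw [hb]; positivity) hγ0 hσ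
    (by rw [ha, hb]; linarith) hρ hr hx₀r
  have hw0 : 0 < 1 - γ * ‖x₀ - xs‖ := lt_of_le_of_lt (by positivity) hw
  have hD := ProxGN.two_sq_sub_one_pos hw
  set w := 1 - γ * ‖x₀ - xs‖ with hw_def
  set θ := ProxGN.rateNumerator κ a b w / (2 * w ^ 2 - 1) ^ 2 with hθ
  have hθ1 : θ < 1 := (div_lt_one (by positivity)).2 hlt
  have hbound : ∀ σ, 0 ≤ σ → σ ≤ ‖x₀ - xs‖ → ProxGN.stepBound β c γ κ w σ ≤ θ * σ := by
    intro σ hσ0 hσle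
    rw [hθ, ha, hb]
    refine ProxGN.stepBound_le hβ0.le hc0 hκ1 hw0.le hγ0 hσ0 ?_
    have := mul_le_mul_of_nonneg_left hσle hγ0
    linarith
  have hθ0 : 0 ≤ θ := by
    have hγσ : 0 ≤ γ * ‖x₀ - xs‖ := by positivity
    have h1 : 0 ≤ 1 - w := by linarith
    have h2 : 0 ≤ κ - 1 := by linarith
    rw [hθ, ProxGN.rateNumerator, ha, hb]
    positivity
  have hball : Metric.ball xs δ ⊆ Ω := hδ ▸ ProxGN.ball_sSup_subset Ω xs hR
  obtain ⟨x, h0, hstep, hle, hlim, hrate⟩ := ProxGN.exists_orbit_tendsto hθ0 hθ1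
    (fun x hx => ProxGN.exists_isProxGNStep (x := x) hΩ hJ hJlsc hF hclosed hβ0 hγ0 hκ1 hstat
      hbelow hcoeff hball (hx₀r.trans_le hrδ) hw0 hD
      (hc ▸ (hbound _ hσ.le le_rfl).trans (mul_le_of_le_one_left hσ.le hθ1.le)) hx)
    (fun σ => hc ▸ hbound σ)
  refine ⟨x, h0, hstep, fun k => mem_ball_iff_norm.2 ((hle k).trans_lt hx₀r), hlim, fun k => ?_⟩
  have h := hrate k
  rw [ProxGN.stepBound, ← hc, ← hw_def, show 1 + w = 2 - γ * ‖x₀ - xs‖ by rw [hw_def]; ring] at h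
  exact h
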